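/- **Setting.** A Boolean circuit with $n$ inputs is a finite directed acyclic graph whose source vertices are the $n$ inputs or constants and whose other vertices are logic gates; each gate applies a Boolean function to the values on its incoming edges and sends the result along its outgoing edges. Its fan-in is the maximum number of incoming edges of a gate. An output is a gate with no outgoing edge. The circuit is $\delta$-noisy if each gate malfunctions, i.e. outputs the negation of its Boolean function evaluated at the values it receives, with probability $\delta$, where the malfunctions of the gates are mutually independent and independent of the inputs. For binary random variables $X, Y$, $$I(X;Y)=\sum_{x,y} P_{X,Y}(x,y)\log_2\frac{P_{X,Y}(x,y)}{P_X(x)P_Y(y)}$$ is their mutual information in bits (with $0\log 0=0$). **Theorem.** Let $\delta\in[0,1]$, let $C$ be a $\delta$-noisy Boolean circuit with $n$ inputs and fan-in at most $k$, let the inputs be independent random variables $X_1,\dots,X_n$ with values in $\{0,1\}$ (with arbitrary distributions), and let $Y$ be the random value of an output of $C$. Suppose that $k(1-2\delta)^2\le 1$. Then for every $i\in\{1,\dots,n\}$ for which there is a directed path from the input $X_i$ to the output $Y$, $$I(X_i;Y)\ \le\ \bigl(k(1-2\delta)^2\bigr)^{d_i},$$ where $d_i$ is the length (number of edges) of a shortest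 directed path from the vertex of $X_i$ to the gate whose value is $Y$. -/

import Mathlib

open MeasureTheory ProbabilityTheory

/-- Edge relation of a wiring diagram: the vertices are the `n` inputs (`Sum.inl i`) and the
remaining nodes (`Sum.inr w`); the node `w` reads its `j`-th argument from the vertex `pred w j`. -/
def WiringEdge {n : ℕ} {W : Type*} {arity : W → ℕ} (pred : ∀ w, Fin (arity w) → Fin n ⊕ W)
    (u v : Fin n ⊕ W) : Prop :=
  ∃ (w : W) (j : Fin (arity w)), v = Sum.inr w ∧ pred w j = u

/-- A Boolean circuit with `n` inputs. The vertices of its directed acyclic graph are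
`Fin n ⊕ W`: the vertex `Sum.inl i` is the `i`-th input, and a vertex `Sum.inr w` is a constant
if it has no incoming edge (`arity w = 0`) and a logic gate otherwise. The value of the node `w`
is the Boolean function `fn w` of the values on its incoming edges. -/
structure BooleanCircuit (n : ℕ) (W : Type*) where
  /-- the number of incoming edges of a node that is not an input -/
  arity : W → ℕ
  /-- the vertices where the incoming edges of a node start -/
  pred : ∀ w, Fin (arity w) → Fin n ⊕ W
  /-- the Boolean function attached to a node -/
  fn : ∀ w, (Fin (arity w) → Bool) → Bool
  /-- there is no directed cycle -/
  acyclic : ∀ v, ¬ Relation.TransGen (WiringEdge pred) v v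

namespace BooleanCircuit

variable {n : ℕ} {W : Type*}

/-- `C.Edge u v`: there is an edge from `u` to `v`. -/
def Edge (C : BooleanCircuit n W) : Fin n ⊕ W → Fin n ⊕ W → Prop := WiringEdge C.pred

/-- The logic gates: the non-input vertices with at least one incoming edge. -/
abbrev Gate (C : BooleanCircuit n W) : Type _ := {w : W // 0 < C.arity w}

/-- The fan-in of a circuit: the maximum number of incoming edges of its gates. -/
def fanIn [Fintype W] (C : BooleanCircuit n W) : ℕ := Finset.univ.sup C.arity

/-- A gate is an output if it has no outgoing edge. -/
def IsOutput (C : BooleanCircuit n W) (g : C.Gate) : Prop := ∀ v, ¬ C.Edge (Sum.inr g.1) v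

/-- The lengths (numbers of edges) of the directed paths from `u` to `v`. Since the graph is
acyclic, the vertices of a directed walk are automatically distinct. -/
def pathLengths (C : BooleanCircuit n W) (u v : Fin n ⊕ W) : Set ℕ :=
  {l | ∃ p : RelSeries {e : (Fin n ⊕ W) × (Fin n ⊕ W) | C.Edge e.1 e.2},
    p.head = u ∧ p.last = v ∧ p.length = l}

theorem edge_wellFounded [Finite W] (C : BooleanCircuit n W) : WellFounded C.Edge := by
  have h : IsStrictOrder (Fin n ⊕ W) (Relation.TransGen C.Edge) :=
    { irrefl := C.acyclic
      trans := fun _ _ _ h₁ h₂ => h₁.trans h₂ }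
  exact Subrelation.wf (fun h => Relation.TransGen.single h)
    (Finite.wellFounded_of_trans_of_irrefl (Relation.TransGen C.Edge))

/-- The value at every vertex when the inputs are `x` and `e g = true` means that the gate `g`
malfunctions, that is, outputs the negation of `fn g` of the values that it receives. Inputs and
constants do not malfunction. -/
def eval [Finite W] (C : BooleanCircuit n W) (x : Fin n → Bool) (e : C.Gate → Bool) :
    Fin n ⊕ W → Bool :=
  C.edge_wellFounded.fix fun v =>
    match v with
    | Sum.inl i => fun _ => x i
    | Sum.inr w => fun val =>
        let a : Bool := C.fn w fun j => val (C.pred w j) ⟨w, j, rfl, rfl⟩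
        if h : 0 < C.arity w then xor a (e ⟨w, h⟩) else a

theorem eval_input [Finite W] (C : BooleanCircuit n W) (x : Fin n → Bool) (e : C.Gate → Bool)
    (i : Fin n) : C.eval x e (Sum.inl i) = x i := by
  rw [eval, WellFounded.fix_eq]

theorem eval_gate [Finite W] (C : BooleanCircuit n W) (x : Fin n → Bool) (e : C.Gate → Bool)
    (g : C.Gate) : C.eval x e (Sum.inr g.1) =
      xor (C.fn g.1 fun j => C.eval x e (C.pred g.1 j)) (e g) := by
  rw [eval, WellFounded.fix_eq]
  simp [g.2]

theorem eval_constant [Finite W] (C : BooleanCircuit n W) (x : Fin n → Bool) (e : C.Gate → Bool)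
    (w : W) (hw : C.arity w = 0) : C.eval x e (Sum.inr w) =
      C.fn w fun j => C.eval x e (C.pred w j) := by
  rw [eval, WellFounded.fix_eq]
  simp [hw]

end BooleanCircuit

/-- Relative entropy, in bits, of two distributions on a finite set, given by their probability
mass functions; it is used only where `P` vanishes wherever `Q` does. -/
noncomputable def relativeEntropy {α : Type*} [Fintype α] (P Q : α → ℝ) : ℝ :=
  ∑ a, P a * Real.logb 2 (P a / Q a)

/-- Mutual information, in bits, of two random variables with finitely many values: the relative
entropy of their joint distribution from the product of their marginal distributions. -/
noncomputable def mutualInformation {Ω : Type*} [MeasurableSpace Ω] (μ : Measure Ω)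
    {α β : Type*} [Fintype α] [Fintype β] (X : Ω → α) (Y : Ω → β) : ℝ :=
  relativeEntropy (fun z : α × β => μ.real {ω | X ω = z.1 ∧ Y ω = z.2})
    (fun z : α × β => μ.real {ω | X ω = z.1} * μ.real {ω | Y ω = z.2})

/-!
The information about the input `X i` is followed backwards through the circuit. Let
`η = (1 - 2δ)²`. If `Z` is a noise bit with parameter `δ`, independent of `(X, B, V)`, then
`I(X; B ⊕ Z, V) ≤ (1 - η) I(X; V) + η I(X; B, V)` (`mutualInformation_xor_le`). So, in a set of
vertices whose values are observed, a gate that none of the others depends on may be replaced, with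
probability `η`, by the vertices that it reads, and otherwise be dropped: the information is bounded
by the probability that site percolation reaches `X i`. In the union bound form used here
(`BooleanCircuit.mutualInformation_evalOn_le_sum`), the information carried by a set of vertices is at
most the sum of their weights, for every nonnegative weight that is at least one at `X i` and, at
each gate, at least `η` times the sum of the weights of the arguments. When the fan-in is at most `k`
and `k η ≤ 1`, the weight `(k η) ^ dist(X i, v)`, set to zero at vertices that `X i` does not reach,
has these properties (`BooleanCircuit.mul_sum_distanceWeight_le`).

Since `X` is a bit, `I(X; Y) = H(X) - ∑ y, splitEntropy (P(X = 0, Y = y)) (P(X = 1, Y = y))`, where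
`splitEntropy u v` is the perspective `(u + v) h(u / (u + v))` of the binary entropy `h`. Perspectives
of convex functions are subadditive (`ConvexOn.perspective_add_le`); applied to `-h` this is the data
processing inequality, and applied to `t ↦ h(δ + (1 - 2δ) t) - η h(t)`, which is convex
(`convexOn_binEntropy_noise_sub`), it is the strong data processing inequality above.
-/

/-! ### Entropy of a split mass -/

/-- The perspective `(u + v) * g (u / (u + v))` of a convex function on the unit interval is
subadditive. -/
theorem ConvexOn.perspective_add_le {g : ℝ → ℝ} (hg : ConvexOn ℝ (Set.Icc 0 1) g)
    {u v u' v' : ℝ} (hu : 0 ≤ u) (hv : 0 ≤ v) (hu' : 0 ≤ u') (hv' : 0 ≤ v') :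
    (u + u' + (v + v')) * g ((u + u') / (u + u' + (v + v')))
      ≤ (u + v) * g (u / (u + v)) + (u' + v') * g (u' / (u' + v')) := by
  rcases (add_nonneg hu hv).eq_or_lt with h | h
  · obtain ⟨rfl, rfl⟩ := (add_eq_zero_iff_of_nonneg hu hv).1 h.symm
    simp
  rcases (add_nonneg hu' hv').eq_or_lt with h' | h'
  · obtain ⟨rfl, rfl⟩ := (add_eq_zero_iff_of_nonneg hu' hv').1 h'.symm
    simp
  have hs : 0 < u + u' + (v + v') := by linarith
  have hx : u / (u + v) ∈ Set.Icc (0 : ℝ) 1 :=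
    ⟨by positivity, (div_le_one h).2 (by linarith)⟩
  have hy : u' / (u' + v') ∈ Set.Icc (0 : ℝ) 1 :=
    ⟨by positivity, (div_le_one h').2 (by linarith)⟩
  have ha : 0 ≤ (u + v) / (u + u' + (v + v')) := by positivity
  have hb : 0 ≤ (u' + v') / (u + u' + (v + v')) := by positivity
  have key := hg.2 hx hy ha hb (by field_simp; ring)
  have e : ((u + v) / (u + u' + (v + v'))) • (u / (u + v)) +
      ((u' + v') / (u + u' + (v + v'))) • (u' / (u' + v')) = (u + u') / (u + u' + (v + v')) := by
    simp only [smul_eq_mul]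
    field_simp
  rw [e] at key
  calc _ ≤ (u + u' + (v + v')) * _ := mul_le_mul_of_nonneg_left key hs.le
    _ = _ := by
      simp only [smul_eq_mul]
      field_simp

/-- The entropy (in nats) of splitting a mass `u + v` into the parts `u` and `v`, weighted by the
mass: `(u + v) * binEntropy (u / (u + v))`. -/
noncomputable def splitEntropy (u v : ℝ) : ℝ :=
  Real.negMulLog u + Real.negMulLog v - Real.negMulLog (u + v)

theorem splitEntropy_eq {u v : ℝ} (hu : 0 ≤ u) (hv : 0 ≤ v) :
    splitEntropy u v = (u + v) * Real.binEntropy (u / (u + v)) := by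
  rcases (add_nonneg hu hv).eq_or_lt with h | h
  · obtain ⟨rfl, rfl⟩ := (add_eq_zero_iff_of_nonneg hu hv).1 h.symm
    simp [splitEntropy]
  have e : 1 - u / (u + v) = v / (u + v) := by field_simp; ring
  have key : ∀ t, (u + v) * Real.negMulLog (t / (u + v))
      = Real.negMulLog t + t * Real.log (u + v) := by
    intro t
    rcases eq_or_ne t 0 with rfl | ht
    · simp
    rw [Real.negMulLog, Real.negMulLog, Real.log_div ht h.ne']
    field_simp
    ring
  rw [Real.binEntropy_eq_negMulLog_add_negMulLog_one_sub, e, mul_add, key, key, splitEntropy,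
    show Real.negMulLog (u + v) = -(u + v) * Real.log (u + v) from rfl]
  ring

theorem splitEntropy_nonneg {u v : ℝ} (hu : 0 ≤ u) (hv : 0 ≤ v) : 0 ≤ splitEntropy u v := by
  rw [splitEntropy_eq hu hv]
  rcases (add_nonneg hu hv).eq_or_lt with h | h
  · simp [← h]
  · exact mul_nonneg h.le (Real.binEntropy_nonneg (by positivity)
      ((div_le_one h).2 (by linarith)))

/-- Superadditivity, which is the concavity of conditional entropy in the joint distribution. -/
theorem splitEntropy_add_le {u v u' v' : ℝ} (hu : 0 ≤ u) (hv : 0 ≤ v) (hu' : 0 ≤ u')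
    (hv' : 0 ≤ v') :
    splitEntropy u v + splitEntropy u' v' ≤ splitEntropy (u + u') (v + v') := by
  have h := Real.strictConcave_binEntropy.concaveOn.neg.perspective_add_le hu hv hu' hv'
  rw [splitEntropy_eq hu hv, splitEntropy_eq hu' hv',
    splitEntropy_eq (add_nonneg hu hu') (add_nonneg hv hv')]
  simp only [Pi.neg_apply] at h
  linarith

theorem sum_splitEntropy_le {ι : Type*} (s : Finset ι) {f g : ι → ℝ} (hf : ∀ a, 0 ≤ f a)
    (hg : ∀ a, 0 ≤ g a) :
    ∑ a ∈ s, splitEntropy (f a) (g a) ≤ splitEntropy (∑ a ∈ s, f a) (∑ a ∈ s, g a) := by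
  classical
  induction s using Finset.induction_on with
  | empty => simp [splitEntropy]
  | insert a s ha ih =>
    rw [Finset.sum_insert ha, Finset.sum_insert ha, Finset.sum_insert ha]
    have := splitEntropy_add_le (hf a) (hg a) (Finset.sum_nonneg fun b (_ : b ∈ s) => hf b)
      (Finset.sum_nonneg fun b (_ : b ∈ s) => hg b)
    linarith

/-! ### Contraction of information by a binary symmetric channel -/

/-- The second derivative is `(1 - 2δ)² (1 / (t (1 - t)) - 1 / (s (1 - s)))` with
`s = δ + (1 - 2δ) t`, and `s` is at least as close to `1 / 2` as `t`. -/
theorem convexOn_binEntropy_noise_sub {δ : ℝ} (h0 : 0 ≤ δ) (h1 : δ ≤ 1) :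
    ConvexOn ℝ (Set.Icc 0 1) fun t =>
      Real.binEntropy (δ + (1 - 2 * δ) * t) - (1 - 2 * δ) ^ 2 * Real.binEntropy t := by
  have hs : ∀ t ∈ Set.Ioo (0 : ℝ) 1, 0 < δ + (1 - 2 * δ) * t ∧ δ + (1 - 2 * δ) * t < 1 := by
    rintro t ⟨ht0, ht1⟩
    constructor
    · rcases h0.eq_or_lt with rfl | h
      · linarith
      · nlinarith [mul_nonneg (sub_nonneg.2 h1) ht0.le, mul_pos h (sub_pos.2 ht1)]
    · rcases h0.eq_or_lt with rfl | h
      · linarith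
      · nlinarith [mul_nonneg (sub_nonneg.2 h1) (sub_pos.2 ht1).le, mul_pos h ht0]
  have hd : ∀ p ∈ Set.Ioo (0 : ℝ) 1,
      HasDerivAt Real.binEntropy (Real.log (1 - p) - Real.log p) p := fun p hp =>
    Real.hasDerivAt_binEntropy hp.1.ne' hp.2.ne
  have hlin : ∀ t : ℝ, HasDerivAt (fun t : ℝ => δ + (1 - 2 * δ) * t) (1 - 2 * δ) t := fun t => by
    simpa using ((hasDerivAt_id t).const_mul (1 - 2 * δ)).const_add δ
  have hl : ∀ p ∈ Set.Ioo (0 : ℝ) 1,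
      HasDerivAt (fun p => Real.log (1 - p) - Real.log p) (-1 / (1 - p) - 1 / p) p := by
    rintro p ⟨hp0, hp1⟩
    exact (((hasDerivAt_id p).const_sub 1).log (sub_pos.2 hp1).ne').sub
      ((hasDerivAt_id p).log hp0.ne')
  refine convexOn_of_hasDerivWithinAt2_nonneg (convex_Icc 0 1)
    (f' := fun t => (Real.log (1 - (δ + (1 - 2 * δ) * t)) - Real.log (δ + (1 - 2 * δ) * t))
      * (1 - 2 * δ) - (1 - 2 * δ) ^ 2 * (Real.log (1 - t) - Real.log t))
    (f'' := fun t => ((-1 / (1 - (δ + (1 - 2 * δ) * t)) - 1 / (δ + (1 - 2 * δ) * t))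
      * (1 - 2 * δ)) * (1 - 2 * δ) - (1 - 2 * δ) ^ 2 * (-1 / (1 - t) - 1 / t)) ?_ ?_ ?_ ?_
  · have := Real.binEntropy_continuous
    fun_prop
  · intro t ht
    rw [interior_Icc] at ht
    exact (((hd _ (hs t ht)).comp t (hlin t)).sub ((hd t ht).const_mul _)).hasDerivWithinAt
  · intro t ht
    rw [interior_Icc] at ht
    exact ((((hl _ (hs t ht)).comp t (hlin t)).mul_const _).sub
      ((hl t ht).const_mul _)).hasDerivWithinAt
  · intro t ht
    rw [interior_Icc] at ht
    obtain ⟨hs0, hs1⟩ := hs t ht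
    obtain ⟨ht0, ht1⟩ := ht
    have hq : t * (1 - t) ≤ (δ + (1 - 2 * δ) * t) * (1 - (δ + (1 - 2 * δ) * t)) := by
      nlinarith [mul_nonneg (mul_nonneg h0 (sub_nonneg.2 h1)) (sq_nonneg (1 - 2 * t))]
    have e : ∀ p : ℝ, 0 < p → p < 1 → -1 / (1 - p) - 1 / p = -(1 / (p * (1 - p))) := by
      intro p hp hp'
      have : 1 - p ≠ 0 := (sub_pos.2 hp').ne'
      field_simp
      ring
    rw [e _ hs0 hs1, e t ht0 ht1]
    have := one_div_le_one_div_of_le (mul_pos ht0 (sub_pos.2 ht1)) hq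
    nlinarith [mul_nonneg (sq_nonneg (1 - 2 * δ)) (sub_nonneg.2 this)]

/-- The strong data processing inequality for the binary symmetric channel, for a pair of bits
with unnormalised joint distribution `(a₀, a₁; b₀, b₁)`: the information that the row carries
about the column drops by a factor `(1 - 2δ)²` when the column is flipped with probability `δ`. -/
theorem splitEntropy_noise_le {δ : ℝ} (h0 : 0 ≤ δ) (h1 : δ ≤ 1) {a₀ a₁ b₀ b₁ : ℝ}
    (ha₀ : 0 ≤ a₀) (ha₁ : 0 ≤ a₁) (hb₀ : 0 ≤ b₀) (hb₁ : 0 ≤ b₁) :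
    splitEntropy ((1 - δ) * (a₀ + b₀) + δ * (a₁ + b₁)) (δ * (a₀ + b₀) + (1 - δ) * (a₁ + b₁))
        - splitEntropy ((1 - δ) * a₀ + δ * a₁) (δ * a₀ + (1 - δ) * a₁)
        - splitEntropy ((1 - δ) * b₀ + δ * b₁) (δ * b₀ + (1 - δ) * b₁)
      ≤ (1 - 2 * δ) ^ 2 * (splitEntropy (a₀ + b₀) (a₁ + b₁)
        - splitEntropy a₀ a₁ - splitEntropy b₀ b₁) := by
  have key : ∀ u v : ℝ, 0 ≤ u → 0 ≤ v →
      splitEntropy ((1 - δ) * u + δ * v) (δ * u + (1 - δ) * v)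
        - (1 - 2 * δ) ^ 2 * splitEntropy u v
      = (u + v) * (Real.binEntropy (δ + (1 - 2 * δ) * (u / (u + v)))
        - (1 - 2 * δ) ^ 2 * Real.binEntropy (u / (u + v))) := by
    intro u v hu hv
    have := sub_nonneg.2 h1
    rw [splitEntropy_eq hu hv, splitEntropy_eq (by positivity) (by positivity)]
    rcases (add_nonneg hu hv).eq_or_lt with h | h
    · obtain ⟨rfl, rfl⟩ := (add_eq_zero_iff_of_nonneg hu hv).1 h.symm
      simp
    · have e : (1 - δ) * u + δ * v + (δ * u + (1 - δ) * v) = u + v := by ring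
      have e' : ((1 - δ) * u + δ * v) / (u + v) = δ + (1 - 2 * δ) * (u / (u + v)) := by
        field_simp
        ring
      rw [e, e']
      ring
  have h := (convexOn_binEntropy_noise_sub h0 h1).perspective_add_le ha₀ ha₁ hb₀ hb₁
  simp only [← key _ _ ha₀ ha₁, ← key _ _ hb₀ hb₁,
    ← key _ _ (add_nonneg ha₀ hb₀) (add_nonneg ha₁ hb₁)] at h
  linarith

theorem splitEntropy_chain_rule (a b c d : ℝ) :
    splitEntropy a b + splitEntropy c d + splitEntropy (a + b) (c + d)
      = splitEntropy a c + splitEntropy b d + splitEntropy (a + c) (b + d) := by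
  have e : a + b + (c + d) = a + c + (b + d) := by ring
  simp only [splitEntropy, e]
  ring

/-- The strong data processing inequality, with the entropies of the row given the column. -/
theorem le_splitEntropy_noise {δ : ℝ} (h0 : 0 ≤ δ) (h1 : δ ≤ 1) {a₀ a₁ b₀ b₁ : ℝ}
    (ha₀ : 0 ≤ a₀) (ha₁ : 0 ≤ a₁) (hb₀ : 0 ≤ b₀) (hb₁ : 0 ≤ b₁) :
    (1 - (1 - 2 * δ) ^ 2) * splitEntropy (a₀ + a₁) (b₀ + b₁)
        + (1 - 2 * δ) ^ 2 * (splitEntropy a₀ b₀ + splitEntropy a₁ b₁)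
      ≤ splitEntropy ((1 - δ) * a₀ + δ * a₁) ((1 - δ) * b₀ + δ * b₁)
        + splitEntropy (δ * a₀ + (1 - δ) * a₁) (δ * b₀ + (1 - δ) * b₁) := by
  have h := splitEntropy_noise_le h0 h1 ha₀ ha₁ hb₀ hb₁
  have c1 := splitEntropy_chain_rule a₀ a₁ b₀ b₁
  have c2 := splitEntropy_chain_rule ((1 - δ) * a₀ + δ * a₁) (δ * a₀ + (1 - δ) * a₁)
    ((1 - δ) * b₀ + δ * b₁) (δ * b₀ + (1 - δ) * b₁)
  have e : ∀ u v : ℝ, (1 - δ) * u + δ * v + (δ * u + (1 - δ) * v) = u + v := fun u v => by ring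
  have e1 : (1 - δ) * a₀ + δ * a₁ + ((1 - δ) * b₀ + δ * b₁)
      = (1 - δ) * (a₀ + b₀) + δ * (a₁ + b₁) := by ring
  have e2 : δ * a₀ + (1 - δ) * a₁ + (δ * b₀ + (1 - δ) * b₁)
      = δ * (a₀ + b₀) + (1 - δ) * (a₁ + b₁) := by ring
  rw [e, e, e1, e2] at c2
  linear_combination h - (1 - 2 * δ) ^ 2 * c1 + c2

/-! ### Mutual information with a random bit -/

section Information

variable {Ω : Type*} [MeasurableSpace Ω] {μ : Measure Ω} {β : Type*} [Fintype β]
  [MeasurableSpace β] [MeasurableSingletonClass β]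

theorem measureReal_eq_sum_and_eq [IsFiniteMeasure μ] (p : Ω → Prop) {Y : Ω → β}
    (hY : Measurable Y) : μ.real {ω | p ω} = ∑ y, μ.real {ω | p ω ∧ Y ω = y} := by
  have h := sum_measureReal_preimage_singleton (μ := μ.restrict {ω | p ω}) Finset.univ (f := Y)
    fun y _ => hY (measurableSet_singleton y)
  rw [Finset.coe_univ, Set.preimage_univ, measureReal_restrict_apply_univ] at h
  rw [← h]
  refine Finset.sum_congr rfl fun y _ => ?_
  rw [measureReal_restrict_apply (hY (measurableSet_singleton y)), Set.inter_comm]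
  rfl

theorem measureReal_false_add_true [IsProbabilityMeasure μ] {X : Ω → Bool} (hX : Measurable X) :
    μ.real {ω | X ω = false} + μ.real {ω | X ω = true} = 1 := by
  have := measureReal_eq_sum_and_eq (μ := μ) (fun _ => True) hX
  simp only [Set.ofPred_true, probReal_univ, Fintype.sum_bool, true_and] at this
  rw [this, add_comm]

/-- The identity `I(X; Y) = H(X) - H(X | Y)`; the factor `log 2` converts bits to nats. -/
theorem mutualInformation_mul_log_two [IsProbabilityMeasure μ] {X : Ω → Bool} {Y : Ω → β}
    (hX : Measurable X) (hY : Measurable Y) :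
    mutualInformation μ X Y * Real.log 2
      = splitEntropy (μ.real {ω | X ω = false}) (μ.real {ω | X ω = true})
        - ∑ y, splitEntropy (μ.real {ω | X ω = false ∧ Y ω = y})
          (μ.real {ω | X ω = true ∧ Y ω = y}) := by
  have hq : ∀ y, μ.real {ω | Y ω = y}
      = μ.real {ω | X ω = false ∧ Y ω = y} + μ.real {ω | X ω = true ∧ Y ω = y} := by
    intro y
    rw [measureReal_eq_sum_and_eq (fun ω => Y ω = y) hX, Fintype.sum_bool, add_comm]
    simp only [and_comm]
  have h1 := measureReal_false_add_true (μ := μ) hX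
  have hterm : ∀ x y, μ.real {ω | X ω = x ∧ Y ω = y} * Real.logb 2 (μ.real {ω | X ω = x ∧ Y ω = y}
      / (μ.real {ω | X ω = x} * μ.real {ω | Y ω = y})) * Real.log 2
      = -Real.negMulLog (μ.real {ω | X ω = x ∧ Y ω = y})
        - μ.real {ω | X ω = x ∧ Y ω = y} * Real.log (μ.real {ω | X ω = x})
        - μ.real {ω | X ω = x ∧ Y ω = y} * Real.log (μ.real {ω | Y ω = y}) := by
    intro x y
    rcases (measureReal_nonneg (μ := μ) (s := {ω | X ω = x ∧ Y ω = y})).eq_or_lt with h | h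
    · simp [← h]
    have hx : 0 < μ.real {ω | X ω = x} := h.trans_le (measureReal_mono fun ω hω => hω.1)
    have hy : 0 < μ.real {ω | Y ω = y} := h.trans_le (measureReal_mono fun ω hω => hω.2)
    rw [mul_assoc, Real.logb, div_mul_cancel₀ _ (Real.log_pos one_lt_two).ne',
      Real.log_div h.ne' (mul_pos hx hy).ne', Real.log_mul hx.ne' hy.ne', Real.negMulLog]
    ring
  have hr : ∀ x, Real.negMulLog (μ.real {ω | X ω = x})
      = -∑ y, μ.real {ω | X ω = x ∧ Y ω = y} * Real.log (μ.real {ω | X ω = x}) := by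
    intro x
    rw [← Finset.sum_mul, ← measureReal_eq_sum_and_eq (fun ω => X ω = x) hY, Real.negMulLog]
    ring
  have hy : ∀ y, Real.negMulLog (μ.real {ω | Y ω = y})
      = -(μ.real {ω | X ω = false ∧ Y ω = y} * Real.log (μ.real {ω | Y ω = y}))
        - μ.real {ω | X ω = true ∧ Y ω = y} * Real.log (μ.real {ω | Y ω = y}) := by
    intro y
    nth_rewrite 1 [Real.negMulLog, hq y]
    ring
  rw [mutualInformation, relativeEntropy, Finset.sum_mul,
    Finset.sum_congr rfl fun (z : Bool × β) _ => hterm z.1 z.2]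
  simp only [ Fintype.sum_prod_type,
    Fintype.sum_bool, splitEntropy, h1, ← hq, hr, hy, Real.negMulLog_one, Finset.sum_sub_distrib,
    Finset.sum_add_distrib, Finset.sum_neg_distrib]
  ring

theorem mutualInformation_le_one [IsProbabilityMeasure μ] {X : Ω → Bool} {Y : Ω → β}
    (hX : Measurable X) (hY : Measurable Y) : mutualInformation μ X Y ≤ 1 := by
  have h1 := measureReal_false_add_true (μ := μ) hX
  have h2 : splitEntropy (μ.real {ω | X ω = false}) (μ.real {ω | X ω = true}) ≤ Real.log 2 := by
    rw [splitEntropy_eq measureReal_nonneg measureReal_nonneg, h1, one_mul]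
    exact Real.binEntropy_le_log_two
  have h3 : 0 ≤ ∑ y, splitEntropy (μ.real {ω | X ω = false ∧ Y ω = y})
      (μ.real {ω | X ω = true ∧ Y ω = y}) :=
    Finset.sum_nonneg fun y _ => splitEntropy_nonneg measureReal_nonneg measureReal_nonneg
  have := mutualInformation_mul_log_two (μ := μ) hX hY
  nlinarith [Real.log_pos one_lt_two]

theorem mutualInformation_const [IsProbabilityMeasure μ] {X : Ω → Bool} (hX : Measurable X)
    (b : β) : mutualInformation μ X (fun _ => b) = 0 := by
  classical
  have h := mutualInformation_mul_log_two (μ := μ) hX (measurable_const (a := b))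
  rw [Finset.sum_eq_single b (fun y _ hy => by simp [hy.symm, splitEntropy]) (by simp)] at h
  simp only [and_true, sub_self] at h
  exact (mul_eq_zero.1 h).resolve_right (Real.log_pos one_lt_two).ne'

/-- The data processing inequality. -/
theorem mutualInformation_comp_le [IsProbabilityMeasure μ] {γ : Type*} [Fintype γ]
    [MeasurableSpace γ] [MeasurableSingletonClass γ] {X : Ω → Bool} {Y : Ω → β}
    (hX : Measurable X) (hY : Measurable Y) (g : β → γ) :
    mutualInformation μ X (fun ω => g (Y ω)) ≤ mutualInformation μ X Y := by
  classical
  have hg : Measurable g := measurable_of_finite g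
  have hfib : ∀ x z, μ.real {ω | X ω = x ∧ g (Y ω) = z}
      = ∑ y with g y = z, μ.real {ω | X ω = x ∧ Y ω = y} := by
    intro x z
    rw [measureReal_eq_sum_and_eq _ hY, Finset.sum_filter]
    refine Finset.sum_congr rfl fun y _ => ?_
    split_ifs with h
    · congr 1
      ext ω
      simp only [Set.mem_ofPred_eq]
      constructor
      · rintro ⟨⟨h1, -⟩, h2⟩
        exact ⟨h1, h2⟩
      · rintro ⟨h1, h2⟩
        exact ⟨⟨h1, by rw [h2, h]⟩, h2⟩
    · convert measureReal_empty
      ext ω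
      simp only [Set.mem_ofPred_eq, Set.mem_empty_iff_false, iff_false]
      rintro ⟨⟨-, h1⟩, rfl⟩
      exact h h1
  have h1 := mutualInformation_mul_log_two (μ := μ) hX hY
  have h2 := mutualInformation_mul_log_two (μ := μ) hX (hg.comp hY)
  have h3 : ∑ y, splitEntropy (μ.real {ω | X ω = false ∧ Y ω = y})
      (μ.real {ω | X ω = true ∧ Y ω = y})
      ≤ ∑ z, splitEntropy (μ.real {ω | X ω = false ∧ (g ∘ Y) ω = z})
      (μ.real {ω | X ω = true ∧ (g ∘ Y) ω = z}) := by
    rw [← Finset.sum_fiberwise Finset.univ g]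
    refine Finset.sum_le_sum fun z _ => ?_
    simp only [Function.comp_apply, hfib]
    exact sum_splitEntropy_le _ (fun _ => measureReal_nonneg) (fun _ => measureReal_nonneg)
  refine le_of_mul_le_mul_right ?_ (Real.log_pos one_lt_two)
  change mutualInformation μ X (g ∘ Y) * _ ≤ _
  linarith

/-- The strong data processing inequality conditionally on `V`: if `Z` is noise independent of
everything else, then `I(X; B ⊕ Z, V) - I(X; V) ≤ (1 - 2δ)² (I(X; B, V) - I(X; V))`. -/
theorem mutualInformation_xor_le [IsProbabilityMeasure μ] {X B Z : Ω → Bool} {V : Ω → β}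
    (hX : Measurable X) (hB : Measurable B) (hZ : Measurable Z) (hV : Measurable V)
    (hind : IndepFun (fun ω => (X ω, B ω, V ω)) Z μ) {δ : ℝ}
    (hδ : μ.real {ω | Z ω = true} = δ) :
    mutualInformation μ X (fun ω => (xor (B ω) (Z ω), V ω))
      ≤ (1 - (1 - 2 * δ) ^ 2) * mutualInformation μ X V
        + (1 - 2 * δ) ^ 2 * mutualInformation μ X (fun ω => (B ω, V ω)) := by
  have h0 : 0 ≤ δ := hδ ▸ measureReal_nonneg
  have h1 : δ ≤ 1 := hδ ▸ measureReal_le_one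
  have hδ' : μ.real {ω | Z ω = false} = 1 - δ := by
    have := measureReal_false_add_true (μ := μ) hZ
    linarith
  have hW : Measurable fun ω => (xor (B ω) (Z ω), V ω) :=
    ((measurable_of_finite fun z : Bool × Bool => xor z.1 z.2).comp (hB.prodMk hZ)).prodMk hV
  have hmul : ∀ x b v z, μ.real {ω | (X ω = x ∧ B ω = b ∧ V ω = v) ∧ Z ω = z}
      = μ.real {ω | X ω = x ∧ B ω = b ∧ V ω = v} * μ.real {ω | Z ω = z} := by
    intro x b v z
    have := hind.measure_inter_preimage_eq_mul {(x, b, v)} {z} (measurableSet_singleton _)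
      (measurableSet_singleton _)
    have e : (fun ω => (X ω, B ω, V ω)) ⁻¹' {(x, b, v)} = {ω | X ω = x ∧ B ω = b ∧ V ω = v} := by
      ext ω
      simp
    rw [e] at this
    rw [Measure.real, Measure.real, Measure.real, ← ENNReal.toReal_mul]
    exact congrArg ENNReal.toReal this
  have hnoise : ∀ x b v, μ.real {ω | X ω = x ∧ (xor (B ω) (Z ω), V ω) = (b, v)}
      = (1 - δ) * μ.real {ω | X ω = x ∧ B ω = b ∧ V ω = v}
        + δ * μ.real {ω | X ω = x ∧ B ω = !b ∧ V ω = v} := by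
    intro x b v
    rw [measureReal_eq_sum_and_eq _ hZ, Fintype.sum_bool]
    have e : ∀ z, {ω | (X ω = x ∧ (xor (B ω) (Z ω), V ω) = (b, v)) ∧ Z ω = z}
        = {ω | (X ω = x ∧ B ω = xor b z ∧ V ω = v) ∧ Z ω = z} := by
      intro z
      ext ω
      simp only [Set.mem_ofPred_eq, Prod.mk.injEq]
      constructor <;> rintro ⟨⟨h1, h2, h3⟩, rfl⟩ <;> refine ⟨⟨h1, ?_, h3⟩, rfl⟩
      · rw [← h2]; simp
      · rw [h2]; simp
    rw [e, e, hmul, hmul, hδ, hδ', Bool.xor_true, Bool.xor_false]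
    ring
  have hpair : ∀ x b v, μ.real {ω | X ω = x ∧ (B ω, V ω) = (b, v)}
      = μ.real {ω | X ω = x ∧ B ω = b ∧ V ω = v} := by
    intro x b v
    simp only [Prod.mk.injEq]
  have hsum : ∀ x v, μ.real {ω | X ω = x ∧ V ω = v}
      = μ.real {ω | X ω = x ∧ B ω = false ∧ V ω = v}
        + μ.real {ω | X ω = x ∧ B ω = true ∧ V ω = v} := by
    intro x v
    rw [measureReal_eq_sum_and_eq _ hB, Fintype.sum_bool, add_comm]
    simp only [and_assoc, and_comm (a := V _ = v)]
  have i1 := mutualInformation_mul_log_two (μ := μ) hX hW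
  have i2 := mutualInformation_mul_log_two (μ := μ) hX (hB.prodMk hV)
  have i3 := mutualInformation_mul_log_two (μ := μ) hX hV
  simp only [Fintype.sum_prod_type_right, Fintype.sum_bool, hnoise, hpair, hsum, Bool.not_true,
    Bool.not_false] at i1 i2 i3
  refine le_of_mul_le_mul_right ?_ (Real.log_pos one_lt_two)
  rw [add_mul, mul_assoc, mul_assoc, i1, i2, i3]
  have key := Finset.sum_le_sum fun v (_ : v ∈ Finset.univ) =>
    le_splitEntropy_noise h0 h1
      (measureReal_nonneg (μ := μ) (s := {ω | X ω = false ∧ B ω = false ∧ V ω = v}))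
      (measureReal_nonneg (μ := μ) (s := {ω | X ω = false ∧ B ω = true ∧ V ω = v}))
      (measureReal_nonneg (μ := μ) (s := {ω | X ω = true ∧ B ω = false ∧ V ω = v}))
      (measureReal_nonneg (μ := μ) (s := {ω | X ω = true ∧ B ω = true ∧ V ω = v}))
  simp only [Finset.sum_add_distrib, ← Finset.mul_sum] at key ⊢
  simp only [add_comm (δ * _) ((1 - δ) * _)] at key
  linarith

end Information

/-! ### Weights given by distances -/

namespace BooleanCircuit

variable {n : ℕ} {W : Type*}

theorem succ_mem_pathLengths (C : BooleanCircuit n W) {s u v : Fin n ⊕ W} (h : C.Edge u v) {l : ℕ}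
    (hl : l ∈ C.pathLengths s u) : l + 1 ∈ C.pathLengths s v := by
  obtain ⟨p, rfl, rfl, rfl⟩ := hl
  exact ⟨p.snoc v h, by simp, by simp, by simp⟩

theorem zero_mem_pathLengths (C : BooleanCircuit n W) (s : Fin n ⊕ W) : 0 ∈ C.pathLengths s s :=
  ⟨RelSeries.singleton _ s, rfl, rfl, rfl⟩

open Classical in
/-- The weight `r ^ dist(s, v)` of a vertex `v`, where `dist(s, v)` is the length of a shortest
directed path from `s` to `v`; the weight is zero if there is no such path. -/
noncomputable def distanceWeight (C : BooleanCircuit n W) (s : Fin n ⊕ W) (r : ℝ)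
    (v : Fin n ⊕ W) : ℝ :=
  if (C.pathLengths s v).Nonempty then r ^ sInf (C.pathLengths s v) else 0

theorem distanceWeight_nonneg (C : BooleanCircuit n W) (s : Fin n ⊕ W) {r : ℝ} (hr : 0 ≤ r)
    (v : Fin n ⊕ W) : 0 ≤ C.distanceWeight s r v := by
  unfold distanceWeight
  split_ifs <;> positivity

theorem distanceWeight_self (C : BooleanCircuit n W) (s : Fin n ⊕ W) (r : ℝ) :
    C.distanceWeight s r s = 1 := by
  rw [distanceWeight, if_pos ⟨0, C.zero_mem_pathLengths s⟩,
    Nat.sInf_eq_zero.2 (Or.inl (C.zero_mem_pathLengths s)), pow_zero]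

theorem mul_distanceWeight_le (C : BooleanCircuit n W) (s : Fin n ⊕ W) {r : ℝ} (hr : 0 ≤ r)
    (hr1 : r ≤ 1) {u v : Fin n ⊕ W} (h : C.Edge u v) :
    r * C.distanceWeight s r u ≤ C.distanceWeight s r v := by
  by_cases hu : (C.pathLengths s u).Nonempty
  · have hm := C.succ_mem_pathLengths h (Nat.sInf_mem hu)
    rw [distanceWeight, distanceWeight, if_pos hu, if_pos ⟨_, hm⟩, ← pow_succ']
    exact pow_le_pow_of_le_one hr hr1 (Nat.sInf_le hm)
  · rw [distanceWeight, if_neg hu, mul_zero]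
    exact C.distanceWeight_nonneg s hr v

/-- The weight satisfies the inequality at gates that the percolation bound asks for: each of the at
most `k` arguments of `w` contributes at most a `k`-th part of the weight of `w`. -/
theorem mul_sum_distanceWeight_le [Fintype W] (C : BooleanCircuit n W) (s : Fin n ⊕ W) {k : ℕ}
    (hk : C.fanIn ≤ k) {η : ℝ} (hη : 0 ≤ η) (hle : k * η ≤ 1) (w : W) :
    η * ∑ j, C.distanceWeight s (k * η) (C.pred w j)
      ≤ C.distanceWeight s (k * η) (Sum.inr w) := by
  have hr : 0 ≤ k * η := by positivity
  have har : C.arity w ≤ k := (Finset.le_sup (f := C.arity) (Finset.mem_univ w)).trans hk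
  rcases Nat.eq_zero_or_pos k with rfl | hk0
  · have : IsEmpty (Fin (C.arity w)) := by
      rw [Nat.le_zero.1 har]
      infer_instance
    simpa using C.distanceWeight_nonneg s hr _
  have hk' : (0 : ℝ) < k := by exact_mod_cast hk0
  have hj : ∀ j ∈ Finset.univ, η * C.distanceWeight s (k * η) (C.pred w j)
      ≤ C.distanceWeight s (k * η) (Sum.inr w) / k := by
    intro j _
    rw [le_div_iff₀ hk']
    have := C.mul_distanceWeight_le s hr hle (u := C.pred w j) (v := Sum.inr w) ⟨w, j, rfl, rfl⟩
    linarith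
  rw [Finset.mul_sum]
  refine (Finset.sum_le_sum hj).trans ?_
  rw [Finset.sum_const, Finset.card_univ, Fintype.card_fin, nsmul_eq_mul, mul_div_assoc',
    div_le_iff₀ hk', mul_comm]
  exact mul_le_mul_of_nonneg_left (by exact_mod_cast har) (C.distanceWeight_nonneg s hr _)

/-! ### Values on a set of vertices -/

theorem exists_maximal_vertex [Finite W] (C : BooleanCircuit n W) {T : Set (Fin n ⊕ W)}
    (hT : T.Nonempty) : ∃ v ∈ T, ∀ u ∈ T, ¬ C.Edge v u := by
  have h : IsStrictOrder (Fin n ⊕ W) (flip (Relation.TransGen C.Edge)) :=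
    { irrefl := C.acyclic
      trans := fun _ _ _ h₁ h₂ => Relation.TransGen.trans h₂ h₁ }
  obtain ⟨v, hv, hmax⟩ :=
    (Finite.wellFounded_of_trans_of_irrefl (flip (Relation.TransGen C.Edge))).has_min T hT
  exact ⟨v, hv, fun u hu huv => hmax u hu (Relation.TransGen.single huv)⟩

/-- The values on a set closed under predecessors depend only on the inputs and the malfunctions in
that set. -/
theorem eval_congr [Finite W] (C : BooleanCircuit n W) {D : Set (Fin n ⊕ W)}
    (hD : ∀ u v, C.Edge u v → v ∈ D → u ∈ D) {x x' : Fin n → Bool} {e e' : C.Gate → Bool}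
    (hx : ∀ i, Sum.inl i ∈ D → x i = x' i) (he : ∀ g : C.Gate, Sum.inr g.1 ∈ D → e g = e' g)
    (v : Fin n ⊕ W) (hv : v ∈ D) : C.eval x e v = C.eval x' e' v := by
  induction v using C.edge_wellFounded.induction with
  | _ v ih =>
    rcases v with i | w
    · rw [eval_input, eval_input, hx i hv]
    have hpred : (fun j => C.eval x e (C.pred w j)) = fun j => C.eval x' e' (C.pred w j) := by
      funext j
      have hj : C.Edge (C.pred w j) (Sum.inr w) := ⟨w, j, rfl, rfl⟩
      exact ih _ hj (hD _ _ hj hv)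
    rcases Nat.eq_zero_or_pos (C.arity w) with hw | hw
    · rw [eval_constant _ _ _ _ hw, eval_constant _ _ _ _ hw, hpred]
    · have h1 := C.eval_gate x e ⟨w, hw⟩
      have h2 := C.eval_gate x' e' ⟨w, hw⟩
      simp only at h1 h2
      rw [h1, h2, hpred, he ⟨w, hw⟩ hv]

open Classical in
/-- The values at the vertices of `S`. They are encoded as a labelling of all the vertices which is
`false` outside `S`, so that the type does not depend on `S`. -/
noncomputable def evalOn [Finite W] (C : BooleanCircuit n W) (S : Set (Fin n ⊕ W))
    (x : Fin n → Bool) (e : C.Gate → Bool) (v : Fin n ⊕ W) : Bool :=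
  if v ∈ S then C.eval x e v else false

theorem evalOn_of_mem [Finite W] (C : BooleanCircuit n W) {S : Set (Fin n ⊕ W)}
    {x : Fin n → Bool} {e : C.Gate → Bool} {v : Fin n ⊕ W} (hv : v ∈ S) :
    C.evalOn S x e v = C.eval x e v := if_pos hv

theorem evalOn_of_notMem [Finite W] (C : BooleanCircuit n W) {S : Set (Fin n ⊕ W)}
    {x : Fin n → Bool} {e : C.Gate → Bool} {v : Fin n ⊕ W} (hv : v ∉ S) :
    C.evalOn S x e v = false := if_neg hv

theorem exists_evalOn_eq_comp [Finite W] (C : BooleanCircuit n W) {R S : Set (Fin n ⊕ W)}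
    (h : R ⊆ S) : ∃ φ : (Fin n ⊕ W → Bool) → Fin n ⊕ W → Bool,
      ∀ x e, C.evalOn R x e = φ (C.evalOn S x e) := by
  classical
  refine ⟨fun y v => if v ∈ R then y v else false, fun x e => ?_⟩
  funext v
  beta_reduce
  by_cases hv : v ∈ R
  · rw [if_pos hv, evalOn_of_mem _ hv, evalOn_of_mem _ (h hv)]
  · rw [if_neg hv, evalOn_of_notMem _ hv]

open Classical in
theorem evalOn_insert [Finite W] (C : BooleanCircuit n W) (R : Set (Fin n ⊕ W)) (v : Fin n ⊕ W)
    (x : Fin n → Bool) (e : C.Gate → Bool) :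
    C.evalOn (insert v R) x e = Function.update (C.evalOn R x e) v (C.eval x e v) := by
  funext u
  rcases eq_or_ne u v with rfl | hu
  · rw [Function.update_self, evalOn_of_mem _ (Set.mem_insert u R)]
  · rw [Function.update_of_ne hu, evalOn, evalOn]
    simp [hu]

/-! ### Percolation bound -/

section Random

variable [Fintype W] {C : BooleanCircuit n W} {Ω : Type*} [MeasurableSpace Ω] {μ : Measure Ω}
  {X : Fin n → Ω → Bool} {E : C.Gate → Ω → Bool}

theorem measurable_eval_comp (hX : ∀ i, Measurable (X i)) (hE : ∀ g, Measurable (E g))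
    {γ : Type*} [MeasurableSpace γ] (F : (Fin n → Bool) → (C.Gate → Bool) → γ) :
    Measurable fun ω => F (fun j => X j ω) (fun g => E g ω) := by
  have : Finite C.Gate := Subtype.finite
  exact (measurable_of_finite fun z : (Fin n → Bool) × (C.Gate → Bool) => F z.1 z.2).comp
    ((measurable_pi_lambda _ hX).prodMk (measurable_pi_lambda _ hE))

/-- The values on a set closed under predecessors are independent of an input or a malfunction
outside that set. -/
theorem indepFun_evalOn [IsProbabilityMeasure μ] (hX : ∀ i, Measurable (X i))
    (hE : ∀ g, Measurable (E g)) (hindep : iIndepFun (Sum.elim X E : Fin n ⊕ C.Gate → Ω → Bool) μ)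
    {D : Set (Fin n ⊕ W)} (hD : ∀ u v, C.Edge u v → v ∈ D → u ∈ D) (s : Fin n ⊕ C.Gate)
    (hs : Sum.map id Subtype.val s ∉ D) :
    IndepFun (fun ω => C.evalOn D (fun j => X j ω) (fun g => E g ω)) (Sum.elim X E s) μ := by
  classical
  have hmeas : ∀ a, Measurable (Sum.elim X E a : Ω → Bool) := by
    rintro (a | a)
    exacts [hX a, hE a]
  have h := hindep.indepFun_finset (Finset.univ.erase s) {s} (by simp) hmeas
  -- the variable at `s` is replaced by `false`
  let extend (t : ↥(Finset.univ.erase s) → Bool) (a : Fin n ⊕ C.Gate) : Bool :=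
    if ha : a ∈ Finset.univ.erase s then t ⟨a, ha⟩ else false
  have h' := h.comp (φ := fun t => C.evalOn D (fun j => extend t (Sum.inl j))
      fun g => extend t (Sum.inr g)) (ψ := fun t => t ⟨s, Finset.mem_singleton_self s⟩)
    (measurable_of_finite _) (measurable_of_finite _)
  refine h'.congr (Filter.Eventually.of_forall fun ω => ?_) (Filter.Eventually.of_forall fun ω => rfl)
  funext v
  by_cases hv : v ∈ D
  · simp only [Function.comp_apply]
    rw [evalOn_of_mem _ hv, evalOn_of_mem _ hv]
    refine C.eval_congr hD (fun j hj => ?_) (fun g hg => ?_) v hv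
    · have : Sum.inl j ≠ s := by
        rintro rfl
        exact hs hj
      simp [extend, this]
    · have : Sum.inr g ≠ s := by
        rintro rfl
        exact hs hg
      simp [extend, this]
  · simp only [Function.comp_apply]
    rw [evalOn_of_notMem _ hv, evalOn_of_notMem _ hv]

open Classical in
/-- One step of the percolation bound: revealing the value at a vertex `v` whose value is a noisy
version of a function `B` of the values at earlier vertices. -/
theorem mutualInformation_evalOn_insert_le [IsProbabilityMeasure μ] (hX : ∀ i, Measurable (X i))
    (hE : ∀ g, Measurable (E g)) (hindep : iIndepFun (Sum.elim X E : Fin n ⊕ C.Gate → Ω → Bool) μ)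
    (i : Fin n) {D R : Set (Fin n ⊕ W)} (hD : ∀ u v, C.Edge u v → v ∈ D → u ∈ D) (hRD : R ⊆ D)
    (s : Fin n ⊕ C.Gate) (hs : Sum.map id Subtype.val s ∉ D) (hi : s ≠ Sum.inl i)
    (f : (Fin n ⊕ W → Bool) → Bool)
    (hf : ∀ ω, C.eval (fun j => X j ω) (fun g => E g ω) (Sum.map id Subtype.val s)
      = xor (f (C.evalOn D (fun j => X j ω) (fun g => E g ω))) (Sum.elim X E s ω))
    {δ : ℝ} (hδ : μ.real {ω | Sum.elim X E s ω = true} = δ) :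
    mutualInformation μ (X i) (fun ω => C.evalOn (insert (Sum.map id Subtype.val s) R)
        (fun j => X j ω) (fun g => E g ω))
      ≤ (1 - (1 - 2 * δ) ^ 2) * mutualInformation μ (X i)
          (fun ω => C.evalOn R (fun j => X j ω) (fun g => E g ω))
        + (1 - 2 * δ) ^ 2 * mutualInformation μ (X i)
          (fun ω => (f (C.evalOn D (fun j => X j ω) (fun g => E g ω)),
            C.evalOn R (fun j => X j ω) (fun g => E g ω))) := by
  have hD' : ∀ u v, C.Edge u v → v ∈ insert (Sum.inl i) D → u ∈ insert (Sum.inl i) D := by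
    rintro u v huv (rfl | hv)
    · obtain ⟨w, j, h, -⟩ := huv
      cases h
    · exact Or.inr (hD u v huv hv)
  have hs' : Sum.map id Subtype.val s ∉ insert (Sum.inl i) D := by
    rintro (h | h)
    · rcases s with j | g
      · exact hi (by simpa using h)
      · simp at h
    · exact hs h
  have hV : ∀ S : Set (Fin n ⊕ W), Measurable fun ω =>
      C.evalOn S (fun j => X j ω) (fun g => E g ω) := fun S =>
    measurable_eval_comp hX hE fun x e => C.evalOn S x e
  have hB : Measurable fun ω => f (C.evalOn D (fun j => X j ω) (fun g => E g ω)) :=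
    (measurable_of_finite f).comp (hV D)
  have hZ : Measurable (Sum.elim X E s : Ω → Bool) := by
    rcases s with a | a
    exacts [hX a, hE a]
  have hind : IndepFun (fun ω => (X i ω, f (C.evalOn D (fun j => X j ω) (fun g => E g ω)),
      C.evalOn R (fun j => X j ω) (fun g => E g ω))) (Sum.elim X E s) μ := by
    obtain ⟨φ, hφ⟩ := C.exists_evalOn_eq_comp (Set.subset_insert (Sum.inl i) D)
    obtain ⟨ψ, hψ⟩ := C.exists_evalOn_eq_comp hRD
    refine ((indepFun_evalOn hX hE hindep hD' s hs').comp
      (φ := fun y => (y (Sum.inl i), f (φ y), ψ (φ y)))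
      (ψ := id) (measurable_of_finite _) measurable_id).congr
      (Filter.Eventually.of_forall fun ω => ?_) (Filter.Eventually.of_forall fun ω => rfl)
    simp only [Function.comp_apply]
    rw [hψ, hφ, evalOn_of_mem _ (Set.mem_insert _ _), eval_input]
  refine le_trans ?_ (mutualInformation_xor_le (hX i) hB hZ (hV R) hind hδ)
  have := mutualInformation_comp_le (μ := μ) (hX i)
    (Y := fun ω => (C.eval (fun j => X j ω) (fun g => E g ω) (Sum.map id Subtype.val s),
      C.evalOn R (fun j => X j ω) (fun g => E g ω)))
    (measurable_eval_comp hX hE fun x e => (C.eval x e (Sum.map id Subtype.val s), C.evalOn R x e))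
    (fun z => Function.update z.2 (Sum.map id Subtype.val s) z.1)
  simpa only [evalOn_insert, hf] using this

open Classical in
/-- The percolation bound: a weight `c` that is at least one at the input `i` and that dominates, at
each gate, `(1 - 2δ)²` times the sum of the weights of its arguments bounds the information about
`X i`. The vertices are removed one by one, starting with those that nothing else depends on. -/
theorem mutualInformation_evalOn_le_sum [IsProbabilityMeasure μ] {δ : ℝ} (h0 : 0 ≤ δ) (h1 : δ ≤ 1)
    (hX : ∀ i, Measurable (X i)) (hE : ∀ g, Measurable (E g))
    (hprob : ∀ g, μ.real {ω | E g ω = true} = δ)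
    (hindep : iIndepFun (Sum.elim X E : Fin n ⊕ C.Gate → Ω → Bool) μ) (i : Fin n)
    {c : Fin n ⊕ W → ℝ} (hc : ∀ v, 0 ≤ c v) (hci : 1 ≤ c (Sum.inl i))
    (hcg : ∀ w, (1 - 2 * δ) ^ 2 * ∑ j, c (C.pred w j) ≤ c (Sum.inr w))
    (T : Finset (Fin n ⊕ W)) (hT : ∀ u v, C.Edge u v → v ∈ T → u ∈ T)
    (S : Finset (Fin n ⊕ W)) (hST : S ⊆ T) :
    mutualInformation μ (X i) (fun ω => C.evalOn S (fun j => X j ω) (fun g => E g ω))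
      ≤ ∑ v ∈ S, c v := by
  have hV : ∀ S : Set (Fin n ⊕ W), Measurable fun ω =>
      C.evalOn S (fun j => X j ω) (fun g => E g ω) := fun S =>
    measurable_eval_comp hX hE fun x e => C.evalOn S x e
  induction T using Finset.strongInduction generalizing S with
  | H T ih =>
    rcases T.eq_empty_or_nonempty with rfl | hne
    · obtain rfl := Finset.subset_empty.1 hST
      have : (fun ω => C.evalOn ((∅ : Finset (Fin n ⊕ W)) : Set (Fin n ⊕ W)) (fun j => X j ω)
          (fun g => E g ω)) = fun _ _ => false := by
        funext ω v
        exact evalOn_of_notMem _ (by simp)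
      rw [this, mutualInformation_const (hX i), Finset.sum_empty]
    obtain ⟨v, hvT, hmax⟩ := C.exists_maximal_vertex (T := (T : Set (Fin n ⊕ W))) hne
    have hD : ∀ u u', C.Edge u u' → u' ∈ T.erase v → u ∈ T.erase v := by
      intro u u' huu' hu'
      have hu'T := Finset.mem_of_mem_erase hu'
      refine Finset.mem_erase.2 ⟨?_, hT u u' huu' hu'T⟩
      rintro rfl
      exact hmax u' hu'T huu'
    have IH := ih (T.erase v) (Finset.erase_ssubset hvT) hD
    by_cases hvS : v ∈ S
    swap
    · exact IH S fun u hu => Finset.mem_erase.2 ⟨fun h => hvS (h ▸ hu), hST hu⟩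
    obtain ⟨R, hvR, rfl⟩ : ∃ R, v ∉ R ∧ insert v R = S :=
      ⟨S.erase v, Finset.notMem_erase v S, Finset.insert_erase hvS⟩
    have hRT : R ⊆ T.erase v := fun u hu =>
      Finset.mem_erase.2 ⟨fun h => hvR (h ▸ hu), hST (Finset.mem_insert_of_mem hu)⟩
    have IHR := IH R hRT
    have hcR : 0 ≤ ∑ u ∈ R, c u := Finset.sum_nonneg fun u _ => hc u
    rw [Finset.sum_insert hvR, Finset.coe_insert]
    have hDc : ∀ u u', C.Edge u u' → u' ∈ (T.erase v : Finset _) → u ∈ (T.erase v : Finset _) := hD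
    have hRc : (R : Set (Fin n ⊕ W)) ⊆ (T.erase v : Finset _) := Finset.coe_subset.2 hRT
    rcases v with j | w
    · by_cases hji : j = i
      · subst hji
        exact (mutualInformation_le_one (hX j) (hV _)).trans (by linarith)
      -- the value of the input `j` is the constant `false`, flipped by the independent bit `X j`
      · have step := mutualInformation_evalOn_insert_le hX hE hindep i
          (D := ((T.erase (Sum.inl j) : Finset _) : Set (Fin n ⊕ W))) hDc hRc
          (Sum.inl j) (by simp) (by simpa using hji) (fun _ => false) (fun ω => by simp [eval_input])
          rfl
        have hfalse := mutualInformation_comp_le (μ := μ) (hX i) (hV R) fun y => (false, y)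
        have := mul_le_mul_of_nonneg_left hfalse
          (sq_nonneg (1 - 2 * μ.real {ω | Sum.elim X E (Sum.inl j) ω = true}))
        have := hc (Sum.inl j)
        simp only [Sum.map_inl, id] at step
        linarith
    rcases Nat.eq_zero_or_pos (C.arity w) with hw | hw
    · have : IsEmpty (Fin (C.arity w)) := by
        rw [hw]
        infer_instance
      have hconst := mutualInformation_comp_le (μ := μ) (hX i) (hV R)
        fun y => Function.update y (Sum.inr w) (C.fn w isEmptyElim)
      have he : ∀ x e, C.eval x e (Sum.inr w) = C.fn w isEmptyElim := fun x e => by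
        rw [C.eval_constant x e w hw]
        congr 1
        exact Subsingleton.elim _ _
      simp only [evalOn_insert, he]
      have := hc (Sum.inr w)
      linarith
    have hpred : ∀ j, C.pred w j ∈ T.erase (Sum.inr w) := fun j => by
      have hj : C.Edge (C.pred w j) (Sum.inr w) := ⟨w, j, rfl, rfl⟩
      have hjT := hT _ _ hj hvT
      refine Finset.mem_erase.2 ⟨fun h => ?_, hjT⟩
      exact C.acyclic _ (Relation.TransGen.single (h ▸ hj : C.Edge (Sum.inr w) (Sum.inr w)))
    have step := mutualInformation_evalOn_insert_le hX hE hindep i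
      (D := ((T.erase (Sum.inr w) : Finset _) : Set (Fin n ⊕ W))) hDc hRc
      (Sum.inr ⟨w, hw⟩) (by simp) (by simp) (fun y => C.fn w fun j => y (C.pred w j))
      (fun ω => by
        have := C.eval_gate (fun j => X j ω) (fun g => E g ω) ⟨w, hw⟩
        simp only at this
        simp only [Sum.map_inr, this, Sum.elim_inr]
        congr 2
        funext j
        rw [evalOn_of_mem _ (Finset.mem_coe.2 (hpred j))])
      (hprob ⟨w, hw⟩)
    set P := R ∪ Finset.univ.image (C.pred w) with hP
    have hPT : P ⊆ T.erase (Sum.inr w) := Finset.union_subset hRT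
      (Finset.image_subset_iff.2 fun j _ => hpred j)
    have hjP : ∀ j, C.pred w j ∈ (P : Set (Fin n ⊕ W)) := fun j => by simp [hP]
    obtain ⟨φ, hφ⟩ := C.exists_evalOn_eq_comp
      (Finset.coe_subset.2 Finset.subset_union_left : (R : Set (Fin n ⊕ W)) ⊆ P)
    have hargs := mutualInformation_comp_le (μ := μ) (hX i) (hV P)
      fun y => (C.fn w fun j => y (C.pred w j), φ y)
    simp only [← hφ, evalOn_of_mem _ (hjP _)] at hargs
    simp only [evalOn_of_mem _ (Finset.mem_coe.2 (hpred _)), Sum.map_inr] at step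
    have hsum : ∑ u ∈ P, c u ≤ ∑ u ∈ R, c u + ∑ j, c (C.pred w j) := by
      have h2 := Finset.sum_union_inter (s₁ := R) (s₂ := Finset.univ.image (C.pred w)) (f := c)
      have h3 : 0 ≤ ∑ u ∈ R ∩ Finset.univ.image (C.pred w), c u :=
        Finset.sum_nonneg fun u _ => hc u
      have h4 : ∑ u ∈ Finset.univ.image (C.pred w), c u ≤ ∑ j, c (C.pred w j) :=
        Finset.sum_image_le_of_nonneg fun u _ => hc u
      linarith
    have hη : 0 ≤ 1 - (1 - 2 * δ) ^ 2 := by nlinarith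
    have m1 := mul_le_mul_of_nonneg_left IHR hη
    have m2 := mul_le_mul_of_nonneg_left ((hargs.trans (IH P hPT)).trans hsum)
      (sq_nonneg (1 - 2 * δ))
    have := hcg w
    linarith

end Random

end BooleanCircuit

/-! ### Information at an output -/

theorem theorem5p7 {n : ℕ} {W : Type*} [Fintype W] (C : BooleanCircuit n W)
    (k : ℕ) (hk : C.fanIn ≤ k) (out : C.Gate) (hout : C.IsOutput out)
    (δ : ℝ) (hδ : δ ∈ Set.Icc (0 : ℝ) 1)
    {Ω : Type*} [MeasurableSpace Ω] (μ : Measure Ω) [IsProbabilityMeasure μ]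
    -- the random inputs, and the events that the gates malfunction
    (X : Fin n → Ω → Bool) (E : C.Gate → Ω → Bool)
    (hX : ∀ i, Measurable (X i)) (hE : ∀ g, Measurable (E g))
    (hprob : ∀ g, μ.real {ω | E g ω = true} = δ)
    (hindep : iIndepFun (Sum.elim X E : Fin n ⊕ C.Gate → Ω → Bool) μ)
    (hle : (k : ℝ) * (1 - 2 * δ) ^ 2 ≤ 1)
    (i : Fin n) (d : ℕ)
    (hd : IsLeast (C.pathLengths (Sum.inl i) (Sum.inr out.1)) d) :
    mutualInformation μ (X i)
        (fun ω => C.eval (fun j => X j ω) (fun g => E g ω) (Sum.inr out.1))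
      ≤ ((k : ℝ) * (1 - 2 * δ) ^ 2) ^ d := by

  classical
  have hr : (0 : ℝ) ≤ k * (1 - 2 * δ) ^ 2 := by positivity
  have hbound := BooleanCircuit.mutualInformation_evalOn_le_sum hδ.1 hδ.2 hX hE hprob hindep i
    (C.distanceWeight_nonneg (Sum.inl i) hr) (C.distanceWeight_self (Sum.inl i) _).ge
    (C.mul_sum_distanceWeight_le (Sum.inl i) hk (sq_nonneg _) hle) Finset.univ
    (fun _ _ _ _ => Finset.mem_univ _) {Sum.inr out.1} (Finset.subset_univ _)
  rw [Finset.sum_singleton, BooleanCircuit.distanceWeight, if_pos ⟨d, hd.1⟩, hd.csInf_eq] at hbound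
  refine le_trans ?_ hbound
  have := mutualInformation_comp_le (μ := μ) (hX i)
    (BooleanCircuit.measurable_eval_comp hX hE fun x e =>
      C.evalOn (({Sum.inr out.1} : Finset (Fin n ⊕ W)) : Set (Fin n ⊕ W)) x e)
    fun y => y (Sum.inr out.1)
  simpa only [C.evalOn_of_mem
    (Finset.mem_coe.2 (Finset.mem_singleton_self (Sum.inr out.1)))] using this
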